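/- Let $M,N\ge 0$ be integers, let $X=\{1,\dots,M\}$, and let $\mathcal H_N=\Lambda^N\mathbb C^M$ be the Hilbert space of $N$ spinless fermions on $M$ vertices, with the orthonormal basis $e_I=e_{i_1}\wedge\dots\wedge e_{i_N}$, $I=\{i_1<\dots<i_N\}\subseteq X$. Let $\hat a_i$ and $\hat a_i^\dagger$ be the fermionic annihilation and creation operators of vertex $i$. Fix a self-adjoint operator $H_0$ on $\mathcal H_N$, and for a potential $v\in\mathbb R^M$ put $H(v)=H_0+\sum_{i} v_i\,\hat a_i^\dagger\hat a_i$. A ground state of $H(v)$ is a unit vector $\Psi=\sum_I\Psi_I e_I$ that is an eigenvector of $H(v)$ for its lowest eigenvalue; it is non-degenerate if this eigenvalue is simple. Its density is $\rho=(\rho_i)_{i\in X}$ with $\rho_i=\sum_{I\ni i}|\Psi_I|^2$. A ground state $\Psi$ of $H(v)$ and its density are called uniquely $v$-representable if every $v'\in\mathbb R^M$ such that $\Psi$ is also a ground state of $H(v')$ differs from $v$ by a constant only. Let $$\mathcal P_{M,N}=\Big\{\rho\in\mathbb R^M \;\Big|\; 0\le\rho_i\le 1 \text{ for all } i,\ \sum_{i=1}^M\rho_i=N\Big\},$$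 and let $\mathcal U_{M,N}$ be the set of all uniquely $v$-representable densities of non-degenerate ground states of the Hamiltonians $H(v)$, $v\in\mathbb R^M$. Then $\mathcal U_{M,N}\subseteq\mathcal P_{M,N}$, and $\mathcal U_{M,N}$ is open in $\mathcal P_{M,N}$: for every $\rho\in\mathcal U_{M,N}$ there is an $\varepsilon>0$ such that every $\rho'\in\mathcal P_{M,N}$ with $\|\rho'-\rho\|<\varepsilon$ belongs to $\mathcal U_{M,N}$. -/

import Mathlib

namespace LatticeDFT

noncomputable section

/-- The Hilbert space `⋀^N ℂ^M` of `N` spinless fermions on the `M` vertices `Fin M`, written in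
the orthonormal basis of wedge products `e_I = e_{i₁} ∧ ⋯ ∧ e_{i_N}` with `i₁ < ⋯ < i_N`. The basis
is indexed by the `N`-element sets `I = {i₁ < ⋯ < i_N}` of vertices, and the coordinate `Ψ I` of a
state is its coefficient `Ψ_I = ⟨e_I, Ψ⟩`. -/
abbrev FermionSpace (M N : ℕ) : Type :=
  EuclideanSpace ℂ (Set.powersetCard (Fin M) N)

open Classical in
/-- The annihilation operator `a_i` from `N` to `N - 1` particles (it is zero if `N = 0`):
`a_i (e_{i₁} ∧ ⋯ ∧ e_{i_N})` is `(-1)^(k+1) e_{i₁} ∧ ⋯ ∧ e_{i_N}` with the factor `e_{i_k}` removed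
if `i = i_k`, and is zero if `i` is none of the `i_k`. In coordinates,
`(a_i Ψ)_J = (-1)^{#{j ∈ J : j < i}} Ψ_{J ∪ {i}}` if `i ∉ J`, and `0` otherwise. -/
def annihilation {M : ℕ} (N : ℕ) (i : Fin M) :
    FermionSpace M N →ₗ[ℂ] FermionSpace M (N - 1) where
  toFun Ψ := WithLp.toLp 2 fun J =>
    if h : i ∉ J.1 ∧ (insert i J.1).card = N then
      (-1) ^ (J.1.filter (· < i)).card * Ψ ⟨insert i J.1, h.2⟩
    else 0
  map_add' Ψ Φ := by
    ext J
    by_cases h : i ∉ J.1 ∧ (insert i J.1).card = N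
    · simp [h, mul_add]
    · simp [h]
  map_smul' c Ψ := by
    ext J
    by_cases h : i ∉ J.1 ∧ (insert i J.1).card = N
    · simp [h, mul_left_comm]
    · simp [h]

/-- The creation operator `a_i†`, the adjoint of `a_i`. -/
def creation {M : ℕ} (N : ℕ) (i : Fin M) :
    FermionSpace M (N - 1) →ₗ[ℂ] FermionSpace M N :=
  LinearMap.adjoint (annihilation N i)

/-- The action `V = ∑ i, v_i a_i† a_i` of an external potential `v : Fin M → ℝ` on `N`-particle
states. -/
def potentialOp {M : ℕ} (N : ℕ) (v : Fin M → ℝ) :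
    FermionSpace M N →ₗ[ℂ] FermionSpace M N :=
  ∑ i, (v i : ℂ) • (creation N i ∘ₗ annihilation N i)

/-- The Hamiltonian `H(v) = H₀ + V`. -/
def hamiltonian {M N : ℕ} (H₀ : FermionSpace M N →ₗ[ℂ] FermionSpace M N) (v : Fin M → ℝ) :
    FermionSpace M N →ₗ[ℂ] FermionSpace M N :=
  H₀ + potentialOp N v

open Classical in
/-- The particle density `ρ_i = ∑_{I ∋ i} |Ψ_I|²` of a state. -/
def density {M N : ℕ} (Ψ : FermionSpace M N) : Fin M → ℝ :=
  fun i => ∑ I : Set.powersetCard (Fin M) N, if i ∈ I then ‖Ψ I‖ ^ 2 else 0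

/-- The set `𝒫_{M,N}` of physical densities. -/
def physicalDensities (M N : ℕ) : Set (Fin M → ℝ) :=
  {ρ | (∀ i, 0 ≤ ρ i ∧ ρ i ≤ 1) ∧ ∑ i, ρ i = N}

/-- `E` is the lowest eigenvalue (the ground-state energy) of `H`. -/
def IsGroundEnergy {M N : ℕ} (H : FermionSpace M N →ₗ[ℂ] FermionSpace M N) (E : ℝ) : Prop :=
  Module.End.HasEigenvalue H (E : ℂ) ∧
    ∀ E' : ℝ, Module.End.HasEigenvalue H (E' : ℂ) → E ≤ E'

/-- `Ψ` is a (normalized) ground state of `H`. -/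
def IsGroundState {M N : ℕ} (H : FermionSpace M N →ₗ[ℂ] FermionSpace M N)
    (Ψ : FermionSpace M N) : Prop :=
  ‖Ψ‖ = 1 ∧ ∃ E : ℝ, IsGroundEnergy H E ∧ H Ψ = (E : ℂ) • Ψ

/-- `Ψ` is a non-degenerate ground state of `H`: the lowest eigenvalue is simple. -/
def IsNondegenerateGroundState {M N : ℕ} (H : FermionSpace M N →ₗ[ℂ] FermionSpace M N)
    (Ψ : FermionSpace M N) : Prop :=
  ‖Ψ‖ = 1 ∧ ∃ E : ℝ, IsGroundEnergy H E ∧ H Ψ = (E : ℂ) • Ψ ∧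
    Module.finrank ℂ (Module.End.eigenspace H (E : ℂ)) = 1

/-- `Ψ` is a ground state of `H₀ + V`, and every potential `v'` for which `Ψ` is a ground state of
`H₀ + V'` differs from `v` by a constant only. -/
def IsUniquelyRepresentedBy {M N : ℕ} (H₀ : FermionSpace M N →ₗ[ℂ] FermionSpace M N)
    (v : Fin M → ℝ) (Ψ : FermionSpace M N) : Prop :=
  IsGroundState (hamiltonian H₀ v) Ψ ∧
    ∀ v' : Fin M → ℝ, IsGroundState (hamiltonian H₀ v') Ψ → ∃ c : ℝ, ∀ i, v' i = v i + c

/-- The set `𝒰_{M,N}` of uniquely `v`-representable densities that come from non-degenerate ground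
states, for the internal Hamiltonian `H₀`. -/
def uvDensities {M N : ℕ} (H₀ : FermionSpace M N →ₗ[ℂ] FermionSpace M N) : Set (Fin M → ℝ) :=
  {ρ | ∃ (v : Fin M → ℝ) (Ψ : FermionSpace M N),
    IsNondegenerateGroundState (hamiltonian H₀ v) Ψ ∧ IsUniquelyRepresentedBy H₀ v Ψ ∧
      density Ψ = ρ}

end

end LatticeDFT

namespace LatticeDFT

open Filter Topology Metric
open scoped InnerProductSpace

/-! For fixed ρ, the function u ↦ E(u) - ⟨u, ρ⟩, with E the ground-state energy, is concave. If Ψ is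
uniquely represented by v and ρ is its density, v is the strict maximizer among potentials with the
same sum (`groundEnergy_sub_lt`). On a small sphere around v in that hyperplane the strict
inequality survives a small change of ρ by compactness, so for ρ' near ρ the maximum over the ball
is attained at an interior point u. Stationarity there forces the ground state of H(u) to have
density ρ' (`density_eq_of_eventually_le`). The ball must be so small that ground states in it stay
non-degenerate and uniquely represented (`eventually_unique_nondegenerate`). Overlap with Ψ gives
the first. For the second, potentials act diagonally, so two potentials sharing a ground state Φ
differ by a constant on the support of Φ, which contains that of Ψ near v; uniqueness at v then
applies. -/

/-! ### Potentials and densities in the occupation basis -/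

/-- The total potential of an occupied set of vertices. -/
noncomputable def occupationPotential {M N : ℕ} (v : Fin M → ℝ)
    (I : Set.powersetCard (Fin M) N) : ℝ :=
  ∑ i ∈ I.1, v i

-- Removing i is a bijection from the sets containing i to those avoiding it, and the fermionic
-- signs square to 1. For N = 0 both sides vanish.
open Classical in
theorem inner_annihilation {M N : ℕ} (i : Fin M) (Φ Ψ : FermionSpace M N) :
    ⟪annihilation N i Φ, annihilation N i Ψ⟫_ℂ =
      ∑ I : Set.powersetCard (Fin M) N, if i ∈ I.1 then ⟪Φ I, Ψ I⟫_ℂ else 0 := by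
  rw [PiLp.inner_apply, ← Finset.sum_filter]
  symm
  refine Finset.sum_bij_ne_zero
    (fun I hI _ => ⟨I.1.erase i, by
      have h := (Finset.mem_filter.1 hI).2
      have hc : I.1.card = N := I.2
      exact (Finset.card_erase_of_mem h).trans (by rw [hc])⟩)
    (fun _ _ _ => Finset.mem_univ _) ?_ ?_ ?_
  · intro I hI _ J hJ _ h
    have hI' := (Finset.mem_filter.1 hI).2
    have hJ' := (Finset.mem_filter.1 hJ).2
    have h' : I.1.erase i = J.1.erase i := congrArg Subtype.val h
    apply Subtype.ext
    rw [← Finset.insert_erase hI', h', Finset.insert_erase hJ']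
  · intro J _ hJ
    by_cases h : i ∉ J.1 ∧ (insert i J.1).card = N
    · refine ⟨⟨insert i J.1, h.2⟩, by simp, ?_, ?_⟩
      · contrapose! hJ
        simp only [annihilation, LinearMap.coe_mk, AddHom.coe_mk, dif_pos h]
        simp only [RCLike.inner_apply] at hJ ⊢
        rw [map_mul, mul_mul_mul_comm, hJ, mul_zero]
      · exact Subtype.ext (Finset.erase_insert h.1)
    · exact absurd (by simp [annihilation, h]) hJ
  · intro I hI _
    have hI' := (Finset.mem_filter.1 hI).2
    have hc : I.1.card = N := I.2
    have h : i ∉ I.1.erase i ∧ (insert i (I.1.erase i)).card = N := by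
      rw [Finset.insert_erase hI']
      exact ⟨by simp, hc⟩
    have hE : (⟨insert i (I.1.erase i), h.2⟩ : Set.powersetCard (Fin M) N) = I :=
      Subtype.ext (Finset.insert_erase hI')
    simp only [annihilation, LinearMap.coe_mk, AddHom.coe_mk, dif_pos h, hE]
    simp only [RCLike.inner_apply, map_mul, map_pow, map_neg, map_one]
    rw [mul_mul_mul_comm, ← mul_pow]
    simp

/-- Pairing with a basis vector turns each creation operator into an annihilation operator on the
other side, so only the number operators of the occupied vertices remain. -/
theorem potentialOp_apply {M N : ℕ} (v : Fin M → ℝ) (Ψ : FermionSpace M N)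
    (I : Set.powersetCard (Fin M) N) :
    potentialOp N v Ψ I = (occupationPotential v I : ℂ) * Ψ I := by
  classical
  have h : ⟪EuclideanSpace.single I (1 : ℂ), potentialOp N v Ψ⟫_ℂ =
      (occupationPotential v I : ℂ) * Ψ I := by
    simp only [potentialOp, creation, LinearMap.sum_apply, LinearMap.smul_apply,
      LinearMap.comp_apply, inner_sum, inner_smul_right, LinearMap.adjoint_inner_right,
      inner_annihilation, occupationPotential, Complex.ofReal_sum, Finset.sum_mul]
    rw [← Finset.sum_filter_add_sum_filter_not Finset.univ (· ∈ I.1)]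
    rw [Finset.filter_mem_eq_inter, Finset.univ_inter]
    rw [Finset.sum_eq_zero (s := Finset.univ.filter (· ∉ I.1)), add_zero]
    · refine Finset.sum_congr rfl fun i hi => ?_
      rw [Finset.sum_eq_single I]
      · simp [hi]
      · intro J _ hJ
        simp [hJ]
      · simp
    · intro i hi
      rw [Finset.sum_eq_zero, mul_zero]
      intro J _
      by_cases hJ : J = I
      · subst hJ
        simp [(Finset.mem_filter.1 hi).2]
      · simp [hJ]
  rw [← h, EuclideanSpace.inner_single_left, map_one, one_mul]

theorem potentialOp_isSymmetric {M N : ℕ} (v : Fin M → ℝ) :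
    (potentialOp N v : FermionSpace M N →ₗ[ℂ] FermionSpace M N).IsSymmetric := by
  intro Φ Ψ
  simp only [PiLp.inner_apply, potentialOp_apply, RCLike.inner_apply]
  refine Finset.sum_congr rfl fun I _ => ?_
  simp only [map_mul, Complex.conj_ofReal]
  ring

theorem hamiltonian_isSymmetric {M N : ℕ} {H₀ : FermionSpace M N →ₗ[ℂ] FermionSpace M N}
    (hH₀ : H₀.IsSymmetric) (v : Fin M → ℝ) : (hamiltonian H₀ v).IsSymmetric :=
  hH₀.add (potentialOp_isSymmetric v)

theorem sum_mul_density {M N : ℕ} (v : Fin M → ℝ) (Ψ : FermionSpace M N) :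
    ∑ i, v i * density Ψ i = ∑ I, occupationPotential v I * ‖Ψ I‖ ^ 2 := by
  classical
  simp only [density, occupationPotential, Finset.mul_sum, Finset.sum_mul]
  rw [Finset.sum_comm]
  refine Finset.sum_congr rfl fun I _ => ?_
  simp only [mul_ite, mul_zero]
  rw [← Finset.sum_filter]
  refine Finset.sum_congr ?_ fun _ _ => rfl
  ext i
  simp [← Set.powersetCard.mem_coe_iff]

theorem density_smul {M N : ℕ} (c : ℂ) (Ψ : FermionSpace M N) :
    density (c • Ψ) = ‖c‖ ^ 2 • density Ψ := by
  ext i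
  simp [density, Finset.mul_sum, mul_pow]

theorem continuous_density {M N : ℕ} :
    Continuous (density : FermionSpace M N → Fin M → ℝ) := by
  classical
  refine continuous_pi fun i => continuous_finsetSum _ fun I _ => ?_
  split_ifs
  · fun_prop
  · fun_prop

theorem sum_density {M N : ℕ} {Ψ : FermionSpace M N} (hΨ : ‖Ψ‖ = 1) :
    ∑ i, density Ψ i = N := by
  have h := sum_mul_density (fun _ => 1) Ψ
  have hc (I : Set.powersetCard (Fin M) N) : I.1.card = N := I.2
  simp only [one_mul, occupationPotential, Finset.sum_const, hc, ← Finset.mul_sum, nsmul_eq_mul,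
    mul_one] at h
  rw [h, ← EuclideanSpace.norm_sq_eq, hΨ]
  simp

theorem density_mem_physicalDensities {M N : ℕ} {Ψ : FermionSpace M N} (hΨ : ‖Ψ‖ = 1) :
    density Ψ ∈ physicalDensities M N := by
  classical
  refine ⟨fun i => ⟨Finset.sum_nonneg fun I _ => ?_, ?_⟩, sum_density hΨ⟩
  · split_ifs <;> positivity
  · have h : ∑ I, ‖Ψ I‖ ^ 2 = 1 := by rw [← EuclideanSpace.norm_sq_eq, hΨ, one_pow]
    rw [← h]
    refine Finset.sum_le_sum fun I _ => ?_
    split_ifs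
    · exact le_rfl
    · positivity

/-! ### Variational characterization of ground states -/

/-- The expected energy `⟨Ψ, H(v) Ψ⟩` of a state. -/
noncomputable def energy {M N : ℕ} (H₀ : FermionSpace M N →ₗ[ℂ] FermionSpace M N)
    (v : Fin M → ℝ) (Ψ : FermionSpace M N) : ℝ :=
  (⟪H₀ Ψ, Ψ⟫_ℂ).re + ∑ i, v i * density Ψ i

variable {M N : ℕ} {H₀ : FermionSpace M N →ₗ[ℂ] FermionSpace M N}

theorem energy_eq_re_inner (v : Fin M → ℝ) (Ψ : FermionSpace M N) :
    energy H₀ v Ψ = (⟪hamiltonian H₀ v Ψ, Ψ⟫_ℂ).re := by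
  rw [energy, sum_mul_density, hamiltonian, LinearMap.add_apply, inner_add_left, Complex.add_re,
    add_right_inj, PiLp.inner_apply, Complex.re_sum]
  refine Finset.sum_congr rfl fun I _ => ?_
  rw [potentialOp_apply, RCLike.inner_apply, map_mul, Complex.conj_ofReal, mul_left_comm,
    RCLike.mul_conj, Complex.re_ofReal_mul]
  norm_cast

theorem continuous_energy : Continuous fun p : (Fin M → ℝ) × FermionSpace M N =>
    energy H₀ p.1 p.2 := by
  have h₁ : Continuous H₀ := H₀.continuous_of_finiteDimensional
  have h₂ := continuous_density (M := M) (N := N)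
  unfold energy
  fun_prop

/-- At a fixed state the energy is affine in the potential, with slope the density. -/
theorem energy_add (v w : Fin M → ℝ) (Ψ : FermionSpace M N) :
    energy H₀ (v + w) Ψ = energy H₀ v Ψ + ∑ i, w i * density Ψ i := by
  simp only [energy, Pi.add_apply, add_mul, Finset.sum_add_distrib]
  ring

theorem energy_eq_of_eigenvector {v : Fin M → ℝ} {Ψ : FermionSpace M N} {E : ℝ} (hΨ : ‖Ψ‖ = 1)
    (h : hamiltonian H₀ v Ψ = (E : ℂ) • Ψ) : energy H₀ v Ψ = E := by
  rw [energy_eq_re_inner, h, inner_smul_left, inner_self_eq_norm_sq_to_K, hΨ]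
  simp

theorem exists_isMinOn_energy {Ψ₀ : FermionSpace M N} (hΨ₀ : ‖Ψ₀‖ = 1) (v : Fin M → ℝ) :
    ∃ Φ, ‖Φ‖ = 1 ∧ ∀ X : FermionSpace M N, ‖X‖ = 1 → energy H₀ v Φ ≤ energy H₀ v X := by
  have hc : Continuous (energy H₀ v) := continuous_energy.comp (by fun_prop : Continuous (v, ·))
  obtain ⟨Φ, hΦ, h⟩ := (isCompact_sphere (0 : FermionSpace M N) 1).exists_isMinOn
    ⟨Ψ₀, by simpa using hΨ₀⟩ hc.continuousOn
  exact ⟨Φ, by simpa using hΦ, fun X hX => h (by simpa using hX)⟩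

/-- A minimizer of the Rayleigh quotient on the sphere is a critical point, hence an eigenvector. -/
theorem eigenvector_of_forall_energy_le (hH₀ : H₀.IsSymmetric) {v : Fin M → ℝ}
    {Φ : FermionSpace M N} (hΦ : ‖Φ‖ = 1)
    (h : ∀ X : FermionSpace M N, ‖X‖ = 1 → energy H₀ v Φ ≤ energy H₀ v X) :
    hamiltonian H₀ v Φ = (energy H₀ v Φ : ℂ) • Φ := by
  have hS := hamiltonian_isSymmetric hH₀ v
  let T := LinearMap.toContinuousLinearMap (hamiltonian H₀ v)
  have hT : IsSelfAdjoint T := hS.isSelfAdjoint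
  have he (X : FermionSpace M N) : T.reApplyInnerSelf X = energy H₀ v X := by
    rw [energy_eq_re_inner, ContinuousLinearMap.reApplyInnerSelf_apply]
    rfl
  have hmin : IsMinOn T.reApplyInnerSelf (sphere (0 : FermionSpace M N) ‖Φ‖) Φ := by
    intro X hX
    simpa only [Set.mem_ofPred_eq, he] using h X (by simpa [hΦ] using hX)
  have := hT.eq_smul_self_of_isLocalExtrOn (Or.inl hmin.localize)
  rw [ContinuousLinearMap.rayleighQuotient, he, hΦ, one_pow, div_one] at this
  exact this

theorem eigenvalue_ge_of_forall_energy_le {v : Fin M → ℝ} {Φ : FermionSpace M N}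
    (h : ∀ X : FermionSpace M N, ‖X‖ = 1 → energy H₀ v Φ ≤ energy H₀ v X) {E' : ℝ}
    (hE' : Module.End.HasEigenvalue (hamiltonian H₀ v) (E' : ℂ)) : energy H₀ v Φ ≤ E' := by
  obtain ⟨X, hX⟩ := hE'.exists_hasEigenvector
  have hn : ‖X‖ ≠ 0 := norm_ne_zero_iff.2 hX.2
  let Y : FermionSpace M N := ((‖X‖⁻¹ : ℝ) : ℂ) • X
  have hY : ‖Y‖ = 1 := by
    simp [Y, norm_smul, hn]
  have hYE : hamiltonian H₀ v Y = (E' : ℂ) • Y := by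
    rw [map_smul, hX.apply_eq_smul, smul_comm]
  exact (h Y hY).trans (energy_eq_of_eigenvector hY hYE).le

theorem isGroundState_iff (hH₀ : H₀.IsSymmetric) {v : Fin M → ℝ} {Φ : FermionSpace M N} :
    IsGroundState (hamiltonian H₀ v) Φ ↔
      ‖Φ‖ = 1 ∧ ∀ X : FermionSpace M N, ‖X‖ = 1 → energy H₀ v Φ ≤ energy H₀ v X := by
  constructor
  · rintro ⟨hΦ, E, ⟨-, hE⟩, h⟩
    refine ⟨hΦ, fun X hX => ?_⟩
    -- The definition only compares eigenvalues; the minimizer Φ' is an eigenvector, so it links E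
    -- to the energies of all states.
    obtain ⟨Φ', hΦ', hmin⟩ := exists_isMinOn_energy (H₀ := H₀) hΦ v
    have hE' : Module.End.HasEigenvalue (hamiltonian H₀ v) ((energy H₀ v Φ' : ℝ) : ℂ) :=
      Module.End.hasEigenvalue_of_hasEigenvector (x := Φ')
        ⟨Module.End.mem_eigenspace_iff.2 (eigenvector_of_forall_energy_le hH₀ hΦ' hmin),
          by rintro rfl; simp at hΦ'⟩
    rw [energy_eq_of_eigenvector hΦ h]
    exact (hE _ hE').trans (hmin X hX)
  · rintro ⟨hΦ, h⟩
    have hev := eigenvector_of_forall_energy_le hH₀ hΦ h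
    exact ⟨hΦ, energy H₀ v Φ, ⟨Module.End.hasEigenvalue_of_hasEigenvector (x := Φ)
      ⟨Module.End.mem_eigenspace_iff.2 hev, by rintro rfl; simp at hΦ⟩,
      fun _ hE => eigenvalue_ge_of_forall_energy_le h hE⟩, hev⟩

/-! ### Dependence of ground states and their energy on the potential -/

/-- Ground states are upper hemicontinuous in the potential. -/
theorem eventually_groundState_mem (hH₀ : H₀.IsSymmetric) {v : Fin M → ℝ} {Ψ : FermionSpace M N}
    (hΨ : IsGroundState (hamiltonian H₀ v) Ψ) {U : Set (FermionSpace M N)} (hU : IsOpen U)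
    (h : ∀ Φ, IsGroundState (hamiltonian H₀ v) Φ → Φ ∈ U) :
    ∀ᶠ v' in 𝓝 v, ∀ Φ, IsGroundState (hamiltonian H₀ v') Φ → Φ ∈ U := by
  have hK : IsCompact (sphere (0 : FermionSpace M N) 1 \ U) := (isCompact_sphere _ _).diff hU
  rw [isGroundState_iff hH₀] at hΨ
  -- Off U, every state has strictly more energy than the fixed trial state Ψ at v, and by
  -- compactness also at nearby potentials.
  have key := hK.eventually_forall_of_forall_eventually (x₀ := v)
    (P := fun v' X => energy H₀ v' Ψ < energy H₀ v' X) (by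
      rintro X ⟨hX, hXU⟩
      have hX1 : ‖X‖ = 1 := by simpa using hX
      have hc₁ : Continuous fun p : (Fin M → ℝ) × FermionSpace M N => energy H₀ p.1 Ψ :=
        continuous_energy.comp (by fun_prop :
          Continuous fun p : (Fin M → ℝ) × FermionSpace M N => (p.1, Ψ))
      refine (isOpen_lt hc₁ continuous_energy).mem_nhds ?_
      by_contra hlt
      refine hXU (h X ((isGroundState_iff hH₀).2 ⟨hX1, fun Y hY => ?_⟩))
      exact (not_lt.1 hlt).trans (hΨ.2 Y hY))
  filter_upwards [key] with v' hv' Φ hΦ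
  rw [isGroundState_iff hH₀] at hΦ
  by_contra hΦU
  exact (hv' Φ ⟨by simpa using hΦ.1, hΦU⟩).not_ge (hΦ.2 Ψ hΨ.1)

/-- The ground-state energy as a function of the potential. -/
noncomputable def groundEnergy (H₀ : FermionSpace M N →ₗ[ℂ] FermionSpace M N)
    (v : Fin M → ℝ) : ℝ :=
  sInf (energy H₀ v '' sphere (0 : FermionSpace M N) 1)

theorem continuous_groundEnergy : Continuous (groundEnergy H₀) :=
  (isCompact_sphere (0 : FermionSpace M N) 1).continuous_sInf continuous_energy

theorem groundEnergy_eq (hH₀ : H₀.IsSymmetric) {v : Fin M → ℝ} {Ψ : FermionSpace M N}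
    (hΨ : IsGroundState (hamiltonian H₀ v) Ψ) : groundEnergy H₀ v = energy H₀ v Ψ := by
  rw [isGroundState_iff hH₀] at hΨ
  refine IsLeast.csInf_eq ⟨⟨Ψ, by simpa using hΨ.1, rfl⟩, ?_⟩
  rintro _ ⟨X, hX, rfl⟩
  exact hΨ.2 X (by simpa using hX)

theorem exists_isGroundState (hH₀ : H₀.IsSymmetric) {Ψ₀ : FermionSpace M N} (hΨ₀ : ‖Ψ₀‖ = 1)
    (v : Fin M → ℝ) : ∃ Φ, IsGroundState (hamiltonian H₀ v) Φ := by
  simpa only [isGroundState_iff hH₀] using exists_isMinOn_energy hΨ₀ v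

theorem groundEnergy_le (hH₀ : H₀.IsSymmetric) (v : Fin M → ℝ) {X : FermionSpace M N}
    (hX : ‖X‖ = 1) : groundEnergy H₀ v ≤ energy H₀ v X := by
  obtain ⟨Φ, hΦ⟩ := exists_isGroundState hH₀ hX v
  rw [groundEnergy_eq hH₀ hΦ]
  exact ((isGroundState_iff hH₀).1 hΦ).2 X hX

theorem isGroundState_of_energy_le (hH₀ : H₀.IsSymmetric) {v : Fin M → ℝ} {X : FermionSpace M N}
    (hX : ‖X‖ = 1) (h : energy H₀ v X ≤ groundEnergy H₀ v) :
    IsGroundState (hamiltonian H₀ v) X :=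
  (isGroundState_iff hH₀).2 ⟨hX, fun _ hY => h.trans (groundEnergy_le hH₀ v hY)⟩

theorem IsGroundState.apply_eq (hH₀ : H₀.IsSymmetric) {v : Fin M → ℝ} {Ψ : FermionSpace M N}
    (hΨ : IsGroundState (hamiltonian H₀ v) Ψ) :
    hamiltonian H₀ v Ψ = (groundEnergy H₀ v : ℂ) • Ψ := by
  have h := (isGroundState_iff hH₀).1 hΨ
  rw [groundEnergy_eq hH₀ hΨ]
  exact eigenvector_of_forall_energy_le hH₀ h.1 h.2

/-! ### Non-degeneracy and overlap -/

theorem IsNondegenerateGroundState.isGroundState {H : FermionSpace M N →ₗ[ℂ] FermionSpace M N}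
    {Ψ : FermionSpace M N} (h : IsNondegenerateGroundState H Ψ) : IsGroundState H Ψ :=
  ⟨h.1, h.2.imp fun _ hE => ⟨hE.1, hE.2.1⟩⟩

/-- This lets phase-invariant open conditions on the ground states of H(v) be checked on Ψ alone. -/
theorem IsNondegenerateGroundState.exists_phase {H : FermionSpace M N →ₗ[ℂ] FermionSpace M N}
    {Ψ Φ : FermionSpace M N} (hΨ : IsNondegenerateGroundState H Ψ) (hΦ : IsGroundState H Φ) :
    ∃ c : ℂ, ‖c‖ = 1 ∧ Φ = c • Ψ := by
  obtain ⟨hΨ1, E, hE, hHΨ, hfin⟩ := hΨ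
  obtain ⟨hΦ1, E', hE', hHΦ⟩ := hΦ
  obtain rfl : E = E' := le_antisymm (hE.2 _ hE'.1) (hE'.2 _ hE.1)
  obtain ⟨c, hc⟩ := (finrank_eq_one_iff_of_nonzero'
    (⟨Ψ, Module.End.mem_eigenspace_iff.2 hHΨ⟩ : Module.End.eigenspace H (E : ℂ))
    (by rintro h; rw [Subtype.ext_iff] at h; subst h; simp at hΨ1)).1 hfin
    ⟨Φ, Module.End.mem_eigenspace_iff.2 hHΦ⟩
  have hc' : c • Ψ = Φ := congrArg Subtype.val hc
  refine ⟨c, ?_, hc'.symm⟩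
  rw [← hc', norm_smul, hΨ1, mul_one] at hΦ1
  exact hΦ1

/-- A ground state is non-degenerate if no ground state is orthogonal to a given vector. -/
theorem IsGroundState.isNondegenerateGroundState {H : FermionSpace M N →ₗ[ℂ] FermionSpace M N}
    {Ψ Φ : FermionSpace M N} (hΦ : IsGroundState H Φ)
    (h : ∀ X, IsGroundState H X → ⟪Ψ, X⟫_ℂ ≠ 0) : IsNondegenerateGroundState H Φ := by
  have hne := h Φ hΦ
  obtain ⟨hΦ1, E, hE, hHΦ⟩ := hΦ
  refine ⟨hΦ1, E, hE, hHΦ, ?_⟩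
  rw [finrank_eq_one_iff_of_nonzero'
    (⟨Φ, Module.End.mem_eigenspace_iff.2 hHΦ⟩ : Module.End.eigenspace H (E : ℂ))
    (by rintro h; rw [Subtype.ext_iff] at h; subst h; simp at hΦ1)]
  rintro ⟨X, hX⟩
  rw [Module.End.mem_eigenspace_iff] at hX
  -- This c makes X - c • Φ orthogonal to Ψ; if nonzero, its normalization would be a forbidden
  -- ground state.
  let c : ℂ := ⟪Ψ, X⟫_ℂ / ⟪Ψ, Φ⟫_ℂ
  let Y : FermionSpace M N := X - c • Φ
  have hY : ⟪Ψ, Y⟫_ℂ = 0 := by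
    simp only [Y, c, inner_sub_right, inner_smul_right]
    field_simp
    ring
  have hHY : H Y = (E : ℂ) • Y := by
    simp only [Y, map_sub, map_smul, hX, hHΦ, smul_sub]
    rw [smul_comm]
  refine ⟨c, Subtype.ext ?_⟩
  change c • Φ = X
  by_contra hne'
  have hY0 : Y ≠ 0 := fun h0 => hne' (sub_eq_zero.1 h0).symm
  have hn : ‖Y‖ ≠ 0 := norm_ne_zero_iff.2 hY0
  refine h (((‖Y‖⁻¹ : ℝ) : ℂ) • Y) ⟨by simp [norm_smul, hn], E, hE, ?_⟩ ?_
  · rw [map_smul, hHY, smul_comm]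
  · rw [inner_smul_right, hY, mul_zero]

theorem hamiltonian_add (v w : Fin M → ℝ) (Ψ : FermionSpace M N) :
    hamiltonian H₀ (v + w) Ψ = hamiltonian H₀ v Ψ + potentialOp N w Ψ := by
  simp only [hamiltonian, potentialOp, LinearMap.add_apply, LinearMap.sum_apply,
    LinearMap.smul_apply, Pi.add_apply, Complex.ofReal_add, add_smul, Finset.sum_add_distrib,
    add_assoc]

theorem potentialOp_smul (t : ℝ) (w : Fin M → ℝ) (Ψ : FermionSpace M N) :
    potentialOp N (t • w) Ψ = (t : ℂ) • potentialOp N w Ψ := by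
  simp only [potentialOp, LinearMap.sum_apply, LinearMap.smul_apply, Pi.smul_apply, smul_eq_mul,
    Complex.ofReal_mul, Finset.smul_sum, smul_smul]

/-! ### Stability of unique representability -/

/-- If a uniquely represented non-degenerate ground state is an eigenvector of a potential, this
potential is constant. -/
theorem const_of_potentialOp_eq_smul (hH₀ : H₀.IsSymmetric) {v w : Fin M → ℝ}
    {Ψ : FermionSpace M N} (hΨ : IsNondegenerateGroundState (hamiltonian H₀ v) Ψ)
    (hu : IsUniquelyRepresentedBy H₀ v Ψ) {c : ℝ} (hw : potentialOp N w Ψ = (c : ℂ) • Ψ) :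
    ∃ c' : ℝ, ∀ i, w i = c' := by
  have hev := eventually_groundState_mem hH₀ hΨ.isGroundState (U := {X | ⟪Ψ, X⟫_ℂ ≠ 0})
    (isOpen_ne_fun (by fun_prop) (by fun_prop)) (by
      intro Φ hΦ
      obtain ⟨d, hd, rfl⟩ := hΨ.exists_phase hΦ
      have hd0 : d ≠ 0 := by rintro rfl; simp at hd
      simp [inner_self_eq_norm_sq_to_K, hΨ.1, hd0])
  have hlim : Tendsto (fun t : ℝ => v + t • w) (𝓝[>] 0) (𝓝 v) := by
    have : Continuous fun t : ℝ => v + t • w := by fun_prop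
    simpa using (this.tendsto 0).mono_left nhdsWithin_le_nhds
  obtain ⟨t, ht, ht0⟩ := ((hlim.eventually hev).and self_mem_nhdsWithin).exists
  have ht0 : 0 < t := ht0
  obtain ⟨Φ, hΦ⟩ := exists_isGroundState hH₀ hΨ.1 (v + t • w)
  have hne : ⟪Ψ, Φ⟫_ℂ ≠ 0 := ht Φ hΦ
  let E : ℝ := groundEnergy H₀ v + t * c
  have hHΨ : hamiltonian H₀ (v + t • w) Ψ = (E : ℂ) • Ψ := by
    rw [hamiltonian_add, potentialOp_smul, hw, hΨ.isGroundState.apply_eq hH₀, smul_smul, ← add_smul]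
    simp [E]
  -- Eigenvectors of a symmetric operator for different eigenvalues are orthogonal, but Ψ and Φ
  -- overlap.
  have hE : E = groundEnergy H₀ (v + t • w) := by
    have := hamiltonian_isSymmetric hH₀ (v + t • w) Ψ Φ
    rw [hHΨ, hΦ.apply_eq hH₀, inner_smul_left, inner_smul_right, Complex.conj_ofReal] at this
    exact_mod_cast mul_right_cancel₀ hne this
  obtain ⟨d, hd⟩ := hu.2 (v + t • w) (isGroundState_of_energy_le hH₀ hΨ.1
    (by rw [energy_eq_of_eigenvector hΨ.1 hHΨ, hE]))
  refine ⟨d / t, fun i => ?_⟩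
  have := hd i
  simp only [Pi.add_apply, Pi.smul_apply, smul_eq_mul, add_right_inj] at this
  rw [← this]
  field_simp

/-- Near the potential of a uniquely represented non-degenerate ground state, all ground states are
non-degenerate and uniquely represented. -/
theorem eventually_unique_nondegenerate (hH₀ : H₀.IsSymmetric) {v : Fin M → ℝ}
    {Ψ : FermionSpace M N} (hΨ : IsNondegenerateGroundState (hamiltonian H₀ v) Ψ)
    (hu : IsUniquelyRepresentedBy H₀ v Ψ) :
    ∀ᶠ v' in 𝓝 v, ∀ Φ, IsGroundState (hamiltonian H₀ v') Φ →
      IsNondegenerateGroundState (hamiltonian H₀ v') Φ ∧ IsUniquelyRepresentedBy H₀ v' Φ := by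
  have hphase (Φ) (hΦ : IsGroundState (hamiltonian H₀ v) Φ) : ∃ d : ℂ, d ≠ 0 ∧ Φ = d • Ψ := by
    obtain ⟨d, hd, h⟩ := hΨ.exists_phase hΦ
    exact ⟨d, by rintro rfl; simp at hd, h⟩
  have hinner := eventually_groundState_mem hH₀ hΨ.isGroundState (U := {X | ⟪Ψ, X⟫_ℂ ≠ 0})
    (isOpen_ne_fun (by fun_prop) (by fun_prop)) (by
      intro Φ hΦ
      obtain ⟨d, hd, rfl⟩ := hphase Φ hΦ
      simp [inner_self_eq_norm_sq_to_K, hΨ.1, hd])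
  -- There are finitely many coordinates, so near v the support of every ground state contains that
  -- of Ψ.
  have hsupp : ∀ᶠ v' in 𝓝 v, ∀ I, ∀ Φ, IsGroundState (hamiltonian H₀ v') Φ →
      Ψ I ≠ 0 → Φ I ≠ 0 := by
    refine eventually_all.2 fun I => ?_
    by_cases hI : Ψ I = 0
    · simp [hI]
    · filter_upwards [eventually_groundState_mem hH₀ hΨ.isGroundState (U := {X | X I ≠ 0})
        (isOpen_ne_fun (by fun_prop) (by fun_prop)) (by
          intro Φ hΦ
          obtain ⟨d, hd, rfl⟩ := hphase Φ hΦ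
          simp [hd, hI])] with v' hv' Φ hΦ _
      exact hv' Φ hΦ
  filter_upwards [hinner, hsupp] with v' hin hsu Φ hΦ
  refine ⟨hΦ.isNondegenerateGroundState hin, hΦ, fun v'' hv'' => ?_⟩
  obtain ⟨w, rfl⟩ : ∃ w, v'' = v' + w := ⟨v'' - v', by simp⟩
  let c : ℝ := groundEnergy H₀ (v' + w) - groundEnergy H₀ v'
  have hw : potentialOp N w Φ = (c : ℂ) • Φ := by
    have h := hv''.apply_eq hH₀
    rw [hamiltonian_add, hΦ.apply_eq hH₀] at h
    rw [← sub_eq_iff_eq_add'.2 h.symm, ← sub_smul]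
    simp [c]
  -- The total potential of w equals c on the support of Φ, hence on that of Ψ.
  have hw' : potentialOp N w Ψ = (c : ℂ) • Ψ := by
    ext I
    rw [potentialOp_apply, PiLp.smul_apply, smul_eq_mul]
    by_cases hI : Ψ I = 0
    · simp [hI]
    · have h : potentialOp N w Φ I = ((c : ℂ) • Φ) I := by rw [hw]
      rw [potentialOp_apply, PiLp.smul_apply, smul_eq_mul] at h
      rw [mul_right_cancel₀ (hsu I Φ hΦ hI) h]
  obtain ⟨d, hd⟩ := const_of_potentialOp_eq_smul hH₀ hΨ hu hw'
  exact ⟨d, fun i => by simp [hd]⟩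

/-! ### Maximization over potentials and openness -/

/-- If `v` maximizes the concave function `u ↦ E(u) - ⟨u, ρ⟩` locally among potentials with fixed
sum, then `ρ` is the density of the ground state of `H(v)`. -/
theorem density_eq_of_eventually_le (hH₀ : H₀.IsSymmetric) {v : Fin M → ℝ} {Φ : FermionSpace M N}
    (hΦ : IsNondegenerateGroundState (hamiltonian H₀ v) Φ) {ρ : Fin M → ℝ}
    (hρ : ∑ i, ρ i = N)
    (hmax : ∀ᶠ u in 𝓝 v, ∑ i, u i = ∑ i, v i →
      groundEnergy H₀ u - ∑ i, u i * ρ i ≤ groundEnergy H₀ v - ∑ i, v i * ρ i) :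
    density Φ = ρ := by
  -- If nonzero, this is an ascent direction; it has zero sum, so it preserves the constraint.
  let w : Fin M → ℝ := density Φ - ρ
  have hw : ∑ i, w i = 0 := by simp [w, sum_density hΦ.1, hρ]
  by_contra hne
  have hpos : ∑ i, w i * ρ i < ∑ i, w i * density Φ i := by
    have h0 : 0 ≤ ∑ i, w i * w i := Finset.sum_nonneg fun i _ => mul_self_nonneg _
    have h1 : ∑ i, w i * w i = ∑ i, w i * density Φ i - ∑ i, w i * ρ i := by
      simp [w, mul_sub, Finset.sum_sub_distrib]
    have h2 : ∑ i, w i * w i ≠ 0 := by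
      intro h
      rw [Finset.sum_eq_zero_iff_of_nonneg fun i _ => mul_self_nonneg _] at h
      refine hne (funext fun i => ?_)
      exact sub_eq_zero.1 (mul_self_eq_zero.1 (h i (Finset.mem_univ i)))
    have := lt_of_le_of_ne h0 h2.symm
    linarith
  have hcont := continuous_density (M := M) (N := N)
  have hev := eventually_groundState_mem hH₀ hΦ.isGroundState
    (U := {X | ∑ i, w i * ρ i < ∑ i, w i * density X i})
    (isOpen_lt (by fun_prop) (by fun_prop)) (by
      intro X hX
      obtain ⟨d, hd, rfl⟩ := hΦ.exists_phase hX
      simpa [density_smul, hd] using hpos)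
  have hlim : Tendsto (fun t : ℝ => v + t • w) (𝓝[>] 0) (𝓝 v) := by
    have : Continuous fun t : ℝ => v + t • w := by fun_prop
    simpa using (this.tendsto 0).mono_left nhdsWithin_le_nhds
  obtain ⟨t, ⟨ht, htm⟩, ht0⟩ :=
    ((hlim.eventually (hev.and hmax)).and self_mem_nhdsWithin).exists
  have ht0 : 0 < t := ht0
  obtain ⟨X, hX⟩ := exists_isGroundState hH₀ hΦ.1 (v + t • w)
  have h₁ : ∑ i, w i * ρ i < ∑ i, w i * density X i := ht X hX
  have h₂ := htm (by simp [Finset.sum_add_distrib, ← Finset.mul_sum, hw])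
  -- The perturbed ground state X serves as trial state at v: E(v + t • w) ≥ E(v) + t⟨w, density X⟩
  -- > E(v) + t⟨w, ρ⟩, against maximality.
  have h₃ := groundEnergy_le hH₀ v hX.1
  rw [groundEnergy_eq hH₀ hX, energy_add] at h₂
  simp only [Pi.add_apply, Pi.smul_apply, smul_eq_mul, add_mul, Finset.sum_add_distrib, mul_assoc,
    ← Finset.mul_sum] at h₂
  have h₄ := mul_lt_mul_of_pos_left h₁ ht0
  linarith

/-- For a uniquely represented ground state, `u ↦ E(u) - ⟨u, ρ⟩` has a strict maximum at `v` among
potentials with fixed sum. -/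
theorem groundEnergy_sub_lt (hH₀ : H₀.IsSymmetric) {v u : Fin M → ℝ} {Ψ : FermionSpace M N}
    (hu : IsUniquelyRepresentedBy H₀ v Ψ) (hsum : ∑ i, u i = ∑ i, v i) (hne : u ≠ v) :
    groundEnergy H₀ u - ∑ i, u i * density Ψ i < groundEnergy H₀ v - ∑ i, v i * density Ψ i := by
  have h₁ : groundEnergy H₀ u < energy H₀ u Ψ := by
    by_contra h
    obtain ⟨c, hc⟩ := hu.2 u (isGroundState_of_energy_le hH₀ hu.1.1 (not_lt.1 h))
    refine hne (funext fun i => ?_)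
    -- The vertex i guarantees M > 0, so equal sums force the constant c to vanish.
    have hM : (M : ℝ) ≠ 0 := by
      have := i.pos
      positivity
    have hc0 : c = 0 := by
      simpa [hc, Finset.sum_add_distrib, hM] using hsum
    rw [hc, hc0, add_zero]
  rw [groundEnergy_eq hH₀ hu.1]
  simp only [energy] at h₁ ⊢
  linarith

/-- Openness is obtained in the whole hyperplane of densities with sum N. -/
theorem eventually_mem_uvDensities (hH₀ : H₀.IsSymmetric) {ρ : Fin M → ℝ}
    (hρ : ρ ∈ uvDensities H₀) : ∀ᶠ ρ' in 𝓝 ρ, ∑ i, ρ' i = (N : ℝ) → ρ' ∈ uvDensities H₀ := by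
  obtain ⟨v, Ψ, hΨ, hu, rfl⟩ := hρ
  obtain ⟨r, hr, hball⟩ := nhds_basis_closedBall.eventually_iff.1
    (eventually_unique_nondegenerate hH₀ hΨ hu)
  have hclosed : IsClosed {u : Fin M → ℝ | ∑ i, u i = ∑ i, v i} :=
    isClosed_eq (by fun_prop) (by fun_prop)
  have hcE := continuous_groundEnergy (H₀ := H₀)
  have key := ((isCompact_sphere v r).inter_right hclosed).eventually_forall_of_forall_eventually
    (x₀ := density Ψ) (P := fun ρ' u => groundEnergy H₀ u - ∑ i, u i * ρ' i <
      groundEnergy H₀ v - ∑ i, v i * ρ' i) (by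
      rintro u ⟨hur, hus⟩
      refine (isOpen_lt (by fun_prop) (by fun_prop)).mem_nhds
        (groundEnergy_sub_lt hH₀ hu hus ?_)
      rintro rfl
      simp at hur
      exact hr.ne hur)
  filter_upwards [key] with ρ' hρ' hsum
  obtain ⟨u, ⟨hur, hus⟩, humax⟩ := ((isCompact_closedBall v r).inter_right hclosed).exists_isMaxOn
    ⟨v, by simpa using hr.le, rfl⟩
    (f := fun u => groundEnergy H₀ u - ∑ i, u i * ρ' i) (by fun_prop)
  -- By `key`, the value at the center v beats every value on the boundary sphere, so the maximizer
  -- is interior.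
  have hlt : dist u v < r := by
    refine lt_of_le_of_ne hur fun h => ?_
    exact (hρ' u ⟨h, hus⟩).not_ge (humax ⟨by simpa using hr.le, rfl⟩)
  obtain ⟨Φ, hΦ⟩ := exists_isGroundState hH₀ hΨ.1 u
  obtain ⟨hΦn, hΦu⟩ := hball hur Φ hΦ
  refine ⟨u, Φ, hΦn, hΦu, density_eq_of_eventually_le hH₀ hΦn hsum ?_⟩
  filter_upwards [isOpen_ball.mem_nhds (mem_ball.2 hlt)] with u' hu' hs
  exact humax ⟨ball_subset_closedBall hu', hs.trans hus⟩

end LatticeDFT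

theorem mainTheorem3 (M N : ℕ)
    (H₀ : LatticeDFT.FermionSpace M N →ₗ[ℂ] LatticeDFT.FermionSpace M N)
    (hH₀ : H₀.IsSymmetric) :
    LatticeDFT.uvDensities H₀ ⊆ LatticeDFT.physicalDensities M N ∧
      ∀ ρ ∈ LatticeDFT.uvDensities H₀, ∃ ε > (0 : ℝ), ∀ ρ' ∈ LatticeDFT.physicalDensities M N,
        ‖ρ' - ρ‖ < ε → ρ' ∈ LatticeDFT.uvDensities H₀ := by
  refine ⟨?_, fun ρ hρ => ?_⟩
  · rintro _ ⟨v, Ψ, hΨ, -, rfl⟩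
    exact LatticeDFT.density_mem_physicalDensities hΨ.1
  · obtain ⟨ε, hε, h⟩ := Metric.eventually_nhds_iff.1
      (LatticeDFT.eventually_mem_uvDensities hH₀ hρ)
    exact ⟨ε, hε, fun ρ' hρ' hd => h (by rwa [dist_eq_norm]) hρ'.2⟩
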